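/- Let $n\ge 1$, let $A$ be a real $n\times n$ matrix all of whose entries are positive, and let $x\in\mathbb{R}^n$ be a vector all of whose entries are positive. Let $\rho(A)$ denote the spectral radius of $A$; a Perron vector of $A$ is an eigenvector of $A$ for the eigenvalue $\rho(A)$. For integers $k\ge 1$ put $$a_k(A,x)=\max_{1\le i\le n}\frac{(A^kx)_i}{(A^{k-1}x)_i},\qquad b_k(A,x)=\min_{1\le i\le n}\frac{(A^kx)_i}{(A^{k-1}x)_i}.$$ (i) If $A^rx$ is not a Perron vector of $A$ for any integer $r\ge 0$, then $(a_k(A,x))_{k\ge1}$ is strictly decreasing, $(b_k(A,x))_{k\ge1}$ is strictly increasing, and both sequences converge to $\rho(A)$. (ii) If there is an integer $r_0\ge 0$ such that $A^{r_0}x,A^{r_0+1}x,\dots$ are all Perron vectors of $A$, and $r_0$ is the least such integer, then $$b_1(A,x)<\cdots<b_{r_0}(A,x)<b_{r_0+1}(A,x)=b_{r_0+2}(A,x)=\cdots=\rho(A),$$ $$a_1(A,x)>\cdots>a_{r_0}(A,x)>a_{r_0+1}(A,x)=a_{r_0+2}(A,x)=\cdots=\rho(A).$$ (For $r_0=0$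 this says that $a_k(A,x)=b_k(A,x)=\rho(A)$ for all $k\ge1$.) -/

import Mathlib

namespace PerronSeq

variable {ι : Type*} [Fintype ι] [DecidableEq ι]

/-- The Perron value `ρ(A)`: the spectral radius of the real square matrix `A`, that is, the
largest modulus of a complex eigenvalue of `A`. -/
noncomputable def perronValue (A : Matrix ι ι ℝ) : ℝ :=
  (spectralRadius ℂ (A.map (fun t : ℝ => (t : ℂ)))).toReal

/-- A Perron vector of `A`: a (nonzero) eigenvector of `A` for the eigenvalue `ρ(A)`. -/
def IsPerronVector (A : Matrix ι ι ℝ) (v : ι → ℝ) : Prop :=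
  Module.End.HasEigenvector (Matrix.toLin' A) (perronValue A) v

/-- `a_k(A, x) = max_i (A^k x)_i / (A^(k-1) x)_i`, meant for `k ≥ 1`. -/
noncomputable def upperSeq [Nonempty ι] (A : Matrix ι ι ℝ) (x : ι → ℝ) (k : ℕ) : ℝ :=
  Finset.univ.sup' Finset.univ_nonempty
    (fun i => ((A ^ k).mulVec x) i / ((A ^ (k - 1)).mulVec x) i)

/-- `b_k(A, x) = min_i (A^k x)_i / (A^(k-1) x)_i`, meant for `k ≥ 1`. -/
noncomputable def lowerSeq [Nonempty ι] (A : Matrix ι ι ℝ) (x : ι → ℝ) (k : ℕ) : ℝ :=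
  Finset.univ.inf' Finset.univ_nonempty
    (fun i => ((A ^ k).mulVec x) i / ((A ^ (k - 1)).mulVec x) i)

end PerronSeq

namespace PerronSeq

open Filter Topology Matrix

variable {ι : Type*} [Fintype ι]

/-! Put `y = A^k x`, with largest ratio `a` and smallest ratio `b` of `A y` to `y`. The slack `a y -
A y` is nonnegative. If it is nonzero, positivity of `A` makes its image strictly positive, so `a`
strictly drops at the next step; if it is zero, `y` is a positive eigenvector, hence a Perron
vector. The same holds for `b` with `A y - b y`.

For convergence the drop is quantified: where the smallest ratio is attained, the slack equals `(a -
b) y_j`, and `A` spreads it over all coordinates, so `a` falls by at least `δ (a - b)`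
(`exists_contraction`). As `a` converges, the gap tends to 0. The common limit is at least `ρ(A)`
because `A y ≤ a y` with `y > 0` forces `ρ(A) ≤ a`, and at most `ρ(A)` because a limit point of the
normalised iterates is an eigenvector for it. -/

theorem mulVec_pos [Nonempty ι] {A : Matrix ι ι ℝ} (hA : ∀ i j, 0 < A i j) {y : ι → ℝ}
    (hy : ∀ i, 0 < y i) (i : ι) : 0 < (A *ᵥ y) i :=
  Finset.sum_pos (fun j _ => mul_pos (hA i j) (hy j)) Finset.univ_nonempty

theorem mulVec_pos_of_nonneg_of_ne_zero {A : Matrix ι ι ℝ} (hA : ∀ i j, 0 < A i j) {z : ι → ℝ}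
    (hz : ∀ i, 0 ≤ z i) (hz0 : z ≠ 0) (i : ι) : 0 < (A *ᵥ z) i := by
  obtain ⟨j, hj⟩ := Function.ne_iff.mp hz0
  exact Finset.sum_pos' (fun j _ => mul_nonneg (hA i j).le (hz j))
    ⟨j, Finset.mem_univ j, mul_pos (hA i j) ((hz j).lt_of_ne' hj)⟩

/-- If the entries of `y` are comparable up to the factor `C`, as are `A *ᵥ y` and `y`, then for a
nonnegative `z` a single entry `z j = c * y j` forces `A *ᵥ z` to dominate a fixed proportion of
`c • A *ᵥ y`. -/
theorem mul_mulVec_le_mulVec_of_apply_eq {A : Matrix ι ι ℝ} {m : ℝ} (hm : 0 < m)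
    (hmA : ∀ i j, m ≤ A i j) {y z : ι → ℝ} {C : ℝ} (hyz : ∀ i j, y i ≤ C * y j)
    (hC : ∀ i, (A *ᵥ y) i ≤ C * y i) (hC0 : 0 < C) (hz : ∀ i, 0 ≤ z i) {c : ℝ} {j : ι}
    (hj : z j = c * y j) (hc : 0 ≤ c) (i : ι) :
    m / C ^ 2 * c * (A *ᵥ y) i ≤ (A *ᵥ z) i := by
  have h1 : A i j * z j ≤ (A *ᵥ z) i :=
    Finset.single_le_sum (f := fun j => A i j * z j)
      (fun k _ => mul_nonneg (hm.le.trans (hmA i k)) (hz k)) (Finset.mem_univ j)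
  have h2 : (A *ᵥ y) i ≤ C ^ 2 * y j := by
    have := mul_le_mul_of_nonneg_left (hyz i j) hC0.le
    linarith [hC i]
  calc m / C ^ 2 * c * (A *ᵥ y) i ≤ m / C ^ 2 * c * (C ^ 2 * y j) := by gcongr
    _ = m * z j := by rw [hj]; field_simp
    _ ≤ A i j * z j := mul_le_mul_of_nonneg_right (hmA i j) (hz j)
    _ ≤ _ := h1

theorem nonneg_of_mulVec_le [Nonempty ι] {A : Matrix ι ι ℝ} (hA : ∀ i j, 0 < A i j)
    {y : ι → ℝ} (hy : ∀ i, 0 < y i) {a : ℝ} (h : ∀ i, (A *ᵥ y) i ≤ a * y i) : 0 ≤ a := by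
  have i := Classical.arbitrary ι
  exact (pos_of_mul_pos_left ((mulVec_pos hA hy i).trans_le (h i)) (hy i).le).le

/-- Used with `spectralRadius_le` to show the spectral radius finite, so that `toReal` keeps its
value. -/
theorem exists_mulVec_le [Nonempty ι] (A : Matrix ι ι ℝ) :
    ∃ a : ℝ, ∀ i, (A *ᵥ fun _ => (1 : ℝ)) i ≤ a * 1 := by
  obtain ⟨a, ha⟩ := Finite.exists_le (A *ᵥ fun _ => (1 : ℝ))
  exact ⟨a, by simpa using ha⟩

theorem exists_pos_forall_mem_Icc [Nonempty ι] {A : Matrix ι ι ℝ} (hA : ∀ i j, 0 < A i j) :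
    ∃ m M : ℝ, 0 < m ∧ (∀ i j, m ≤ A i j) ∧ ∀ i j, A i j ≤ M := by
  obtain ⟨p, hp⟩ := Finite.exists_min (fun p : ι × ι => A p.1 p.2)
  obtain ⟨q, hq⟩ := Finite.exists_max (fun p : ι × ι => A p.1 p.2)
  exact ⟨A p.1 p.2, A q.1 q.2, hA _ _, fun i j => hp (i, j), fun i j => hq (i, j)⟩

/-- Every entry of `A *ᵥ z` lies between `m ∑ z` and `M ∑ z`, so the bound does not depend on `z`.
-/
theorem mulVec_le_div_mul_mulVec {A : Matrix ι ι ℝ} {m M : ℝ} (hm : 0 < m)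
    (hmA : ∀ i j, m ≤ A i j) (hMA : ∀ i j, A i j ≤ M) {z : ι → ℝ} (hz : ∀ i, 0 ≤ z i) (i j : ι) :
    (A *ᵥ z) i ≤ M / m * (A *ᵥ z) j := by
  have hM : 0 ≤ M := (hm.le.trans (hmA i j)).trans (hMA i j)
  have h1 : (A *ᵥ z) i ≤ M * ∑ l, z l := by
    rw [Finset.mul_sum]
    exact Finset.sum_le_sum fun l _ => mul_le_mul_of_nonneg_right (hMA i l) (hz l)
  have h2 : m * ∑ l, z l ≤ (A *ᵥ z) j := by
    rw [Finset.mul_sum]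
    exact Finset.sum_le_sum fun l _ => mul_le_mul_of_nonneg_right (hmA j l) (hz l)
  calc (A *ᵥ z) i ≤ M * ∑ l, z l := h1
    _ = M / m * (m * ∑ l, z l) := by field_simp
    _ ≤ _ := by gcongr

/-! ### Collatz–Wielandt bounds and positive eigenvectors -/

section Spectrum

variable [DecidableEq ι]

/-- Read the eigenvalue equation at a coordinate where `‖v i‖ / y i` is maximal: there the triangle
inequality costs at most the factor `a`. -/
theorem norm_le_of_mem_spectrum [Nonempty ι] {A : Matrix ι ι ℝ} (hA : ∀ i j, 0 < A i j)
    {y : ι → ℝ} (hy : ∀ i, 0 < y i) {a : ℝ} (h : ∀ i, (A *ᵥ y) i ≤ a * y i) {μ : ℂ}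
    (hμ : μ ∈ spectrum ℂ (A.map (fun t : ℝ => (t : ℂ)))) : ‖μ‖ ≤ a := by
  rw [← Matrix.spectrum_toLin', ← Module.End.hasEigenvalue_iff_mem_spectrum] at hμ
  obtain ⟨v, hv⟩ := hμ.exists_hasEigenvector
  have hv1 := hv.apply_eq_smul
  obtain ⟨i, -, hi⟩ := Finset.exists_max_image Finset.univ (fun i => ‖v i‖ / y i)
    Finset.univ_nonempty
  obtain ⟨l, hl⟩ := Function.ne_iff.mp hv.2
  set c := ‖v i‖ / y i with hcdef
  have hc : 0 < c := (div_pos (norm_pos_iff.mpr hl) (hy l)).trans_le (hi l (Finset.mem_univ l))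
  have hle : ∀ j, ‖v j‖ ≤ c * y j := fun j => (div_le_iff₀ (hy j)).mp (hi j (Finset.mem_univ j))
  have hvi : ‖v i‖ = c * y i := (div_mul_cancel₀ _ (hy i).ne').symm
  have h1 : ‖μ‖ * (c * y i) ≤ a * (c * y i) :=
    calc ‖μ‖ * (c * y i) = ‖∑ j, (A i j : ℂ) * v j‖ := by
          rw [← hvi, ← norm_mul]
          congr 1
          simpa [Matrix.mulVec, dotProduct] using (congrFun hv1 i).symm
      _ ≤ ∑ j, ‖(A i j : ℂ) * v j‖ := norm_sum_le _ _
      _ ≤ ∑ j, c * (A i j * y j) := by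
          refine Finset.sum_le_sum fun j _ => ?_
          rw [norm_mul, Complex.norm_real, Real.norm_of_nonneg (hA i j).le]
          have := mul_le_mul_of_nonneg_left (hle j) (hA i j).le
          linarith
      _ = c * (A *ᵥ y) i := by rw [← Finset.mul_sum]; rfl
      _ ≤ c * (a * y i) := mul_le_mul_of_nonneg_left (h i) hc.le
      _ = a * (c * y i) := by ring
  exact le_of_mul_le_mul_right h1 (mul_pos hc (hy i))

theorem spectralRadius_le [Nonempty ι] {A : Matrix ι ι ℝ} (hA : ∀ i j, 0 < A i j)
    {y : ι → ℝ} (hy : ∀ i, 0 < y i) {a : ℝ} (h : ∀ i, (A *ᵥ y) i ≤ a * y i) :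
    spectralRadius ℂ (A.map (fun t : ℝ => (t : ℂ))) ≤ ENNReal.ofReal a := by
  refine iSup₂_le fun μ hμ => ?_
  have := ENNReal.ofReal_le_ofReal (norm_le_of_mem_spectrum hA hy h hμ)
  rwa [ofReal_norm] at this

theorem perronValue_le [Nonempty ι] {A : Matrix ι ι ℝ} (hA : ∀ i j, 0 < A i j)
    {y : ι → ℝ} (hy : ∀ i, 0 < y i) {a : ℝ} (h : ∀ i, (A *ᵥ y) i ≤ a * y i) :
    perronValue A ≤ a :=
  ENNReal.toReal_le_of_le_ofReal (nonneg_of_mulVec_le hA hy h) (spectralRadius_le hA hy h)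

theorem le_perronValue_of_mulVec_eq [Nonempty ι] {A : Matrix ι ι ℝ} (hA : ∀ i j, 0 < A i j)
    {v : ι → ℝ} (hv : v ≠ 0) {a : ℝ} (h : A *ᵥ v = a • v) : a ≤ perronValue A := by
  have hmem : (a : ℂ) ∈ spectrum ℂ (A.map (fun t : ℝ => (t : ℂ))) := by
    rw [← Matrix.spectrum_toLin', ← Module.End.hasEigenvalue_iff_mem_spectrum]
    refine Module.End.hasEigenvalue_of_hasEigenvector (x := fun i => (v i : ℂ))
      ⟨Module.End.mem_eigenspace_iff.mpr ?_, ?_⟩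
    · ext i
      have := congrFun h i
      simp only [Matrix.mulVec, dotProduct, Pi.smul_apply, smul_eq_mul] at this
      simp only [Matrix.toLin'_apply, Matrix.mulVec, dotProduct, Matrix.map_apply, Pi.smul_apply,
        smul_eq_mul]
      exact_mod_cast this
    · intro h0
      exact hv (funext fun i => by simpa using congrFun h0 i)
  obtain ⟨b, hb⟩ := exists_mulVec_le A
  have hfin := (spectralRadius_le hA (fun _ => one_pos) hb).trans_lt ENNReal.ofReal_lt_top
  have h1 : (‖(a : ℂ)‖₊ : ENNReal) ≤ spectralRadius ℂ (A.map (fun t : ℝ => (t : ℂ))) :=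
    le_iSup₂ (f := fun (k : ℂ) (_ : k ∈ spectrum ℂ (A.map (fun t : ℝ => (t : ℂ)))) =>
      (‖k‖₊ : ENNReal)) _ hmem
  have h2 := ENNReal.toReal_mono hfin.ne h1
  simp only [ENNReal.coe_toReal, coe_nnnorm, Complex.norm_real] at h2
  exact (le_abs_self a).trans h2

theorem isPerronVector_iff {A : Matrix ι ι ℝ} {v : ι → ℝ} :
    IsPerronVector A v ↔ A *ᵥ v = perronValue A • v ∧ v ≠ 0 := by
  rw [IsPerronVector, Module.End.hasEigenvector_iff, Module.End.mem_eigenspace_iff,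
    Matrix.toLin'_apply]

theorem isPerronVector_of_mulVec_eq [Nonempty ι] {A : Matrix ι ι ℝ} (hA : ∀ i j, 0 < A i j)
    {y : ι → ℝ} (hy : ∀ i, 0 < y i) {a : ℝ} (h : A *ᵥ y = a • y) : IsPerronVector A y := by
  have hy0 : y ≠ 0 := fun h0 => (hy (Classical.arbitrary ι)).ne' (congrFun h0 _)
  have ha : perronValue A = a := le_antisymm
    (perronValue_le hA hy fun i => (congrFun h i).le) (le_perronValue_of_mulVec_eq hA hy0 h)
  exact isPerronVector_iff.mpr ⟨ha ▸ h, hy0⟩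

theorem IsPerronVector.mulVec [Nonempty ι] {A : Matrix ι ι ℝ} (hA : ∀ i j, 0 < A i j)
    {y : ι → ℝ} (hy : ∀ i, 0 < y i) (h : IsPerronVector A y) : IsPerronVector A (A *ᵥ y) := by
  refine isPerronVector_of_mulVec_eq hA (mulVec_pos hA hy) (a := perronValue A) ?_
  conv_lhs => rw [(isPerronVector_iff.mp h).1]
  exact Matrix.mulVec_smul A _ y

theorem pow_succ_mulVec (A : Matrix ι ι ℝ) (x : ι → ℝ) (k : ℕ) :
    A ^ (k + 1) *ᵥ x = A *ᵥ (A ^ k *ᵥ x) := by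
  rw [pow_succ', Matrix.mulVec_mulVec]

end Spectrum

/-! ### Ratios along the iterates: strict monotonicity -/

section Iterates

variable [DecidableEq ι] [Nonempty ι] {A : Matrix ι ι ℝ} {x : ι → ℝ}

theorem pow_mulVec_pos (hA : ∀ i j, 0 < A i j) (hx : ∀ i, 0 < x i) (k : ℕ) :
    ∀ i, 0 < (A ^ k *ᵥ x) i := by
  induction k with
  | zero => simpa using hx
  | succ k ih => rw [pow_succ_mulVec]; exact mulVec_pos hA ih

theorem isPerronVector_pow_mulVec_of_le (hA : ∀ i j, 0 < A i j) (hx : ∀ i, 0 < x i) {r s : ℕ}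
    (hrs : r ≤ s) (h : IsPerronVector A (A ^ r *ᵥ x)) : IsPerronVector A (A ^ s *ᵥ x) := by
  induction s, hrs using Nat.le_induction with
  | base => exact h
  | succ s _ ih =>
    rw [pow_succ_mulVec]
    exact ih.mulVec hA (pow_mulVec_pos hA hx s)

/-- Indexing by `k + 1` avoids the truncated `k - 1`. -/
theorem upperSeq_succ_le_iff (hA : ∀ i j, 0 < A i j) (hx : ∀ i, 0 < x i) {k : ℕ} {a : ℝ} :
    upperSeq A x (k + 1) ≤ a ↔ ∀ i, (A *ᵥ (A ^ k *ᵥ x)) i ≤ a * (A ^ k *ᵥ x) i := by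
  simp [upperSeq, div_le_iff₀ (pow_mulVec_pos hA hx k _), pow_succ_mulVec]

theorem upperSeq_succ_lt_iff (hA : ∀ i j, 0 < A i j) (hx : ∀ i, 0 < x i) {k : ℕ} {a : ℝ} :
    upperSeq A x (k + 1) < a ↔ ∀ i, (A *ᵥ (A ^ k *ᵥ x)) i < a * (A ^ k *ᵥ x) i := by
  simp [upperSeq, div_lt_iff₀ (pow_mulVec_pos hA hx k _), pow_succ_mulVec]

theorem le_lowerSeq_succ_iff (hA : ∀ i j, 0 < A i j) (hx : ∀ i, 0 < x i) {k : ℕ} {a : ℝ} :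
    a ≤ lowerSeq A x (k + 1) ↔ ∀ i, a * (A ^ k *ᵥ x) i ≤ (A *ᵥ (A ^ k *ᵥ x)) i := by
  simp [lowerSeq, le_div_iff₀ (pow_mulVec_pos hA hx k _), pow_succ_mulVec]

theorem lt_lowerSeq_succ_iff (hA : ∀ i j, 0 < A i j) (hx : ∀ i, 0 < x i) {k : ℕ} {a : ℝ} :
    a < lowerSeq A x (k + 1) ↔ ∀ i, a * (A ^ k *ᵥ x) i < (A *ᵥ (A ^ k *ᵥ x)) i := by
  simp [lowerSeq, lt_div_iff₀ (pow_mulVec_pos hA hx k _), pow_succ_mulVec]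

theorem exists_lowerSeq_mul_eq (hA : ∀ i j, 0 < A i j) (hx : ∀ i, 0 < x i) (k : ℕ) :
    ∃ j, (A *ᵥ (A ^ k *ᵥ x)) j = lowerSeq A x (k + 1) * (A ^ k *ᵥ x) j := by
  obtain ⟨j, -, hj⟩ := Finset.exists_mem_eq_inf' (Finset.univ_nonempty (α := ι))
    (fun i => ((A ^ (k + 1)) *ᵥ x) i / ((A ^ (k + 1 - 1)) *ᵥ x) i)
  refine ⟨j, ?_⟩
  rw [lowerSeq, hj, ← pow_succ_mulVec]
  exact (div_mul_cancel₀ _ (pow_mulVec_pos hA hx k j).ne').symm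

theorem mulVec_le_upperSeq_mul (hA : ∀ i j, 0 < A i j) (hx : ∀ i, 0 < x i) (k : ℕ) (i : ι) :
    (A *ᵥ (A ^ k *ᵥ x)) i ≤ upperSeq A x (k + 1) * (A ^ k *ᵥ x) i :=
  (upperSeq_succ_le_iff hA hx).mp le_rfl i

theorem lowerSeq_mul_le_mulVec (hA : ∀ i j, 0 < A i j) (hx : ∀ i, 0 < x i) (k : ℕ) (i : ι) :
    lowerSeq A x (k + 1) * (A ^ k *ᵥ x) i ≤ (A *ᵥ (A ^ k *ᵥ x)) i :=
  (le_lowerSeq_succ_iff hA hx).mp le_rfl i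

theorem lowerSeq_le_upperSeq (A : Matrix ι ι ℝ) (x : ι → ℝ) (k : ℕ) :
    lowerSeq A x k ≤ upperSeq A x k :=
  (Finset.inf'_le _ (Finset.mem_univ (Classical.arbitrary ι))).trans
    (Finset.le_sup' (fun i => (A ^ k *ᵥ x) i / (A ^ (k - 1) *ᵥ x) i) (Finset.mem_univ _))

theorem upperSeq_succ_lt (hA : ∀ i j, 0 < A i j) (hx : ∀ i, 0 < x i) {k : ℕ}
    (h : ¬ IsPerronVector A (A ^ k *ᵥ x)) : upperSeq A x (k + 2) < upperSeq A x (k + 1) := by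
  rw [upperSeq_succ_lt_iff hA hx]
  intro i
  have := mulVec_pos_of_nonneg_of_ne_zero hA
    (z := upperSeq A x (k + 1) • (A ^ k *ᵥ x) - A *ᵥ (A ^ k *ᵥ x))
    (fun i => sub_nonneg.mpr (mulVec_le_upperSeq_mul hA hx k i))
    (fun h0 => h (isPerronVector_of_mulVec_eq hA (pow_mulVec_pos hA hx k) (sub_eq_zero.mp h0).symm))
    i
  rw [Matrix.mulVec_sub, Matrix.mulVec_smul] at this
  rw [pow_succ_mulVec]
  exact sub_pos.mp this

theorem lt_lowerSeq_succ (hA : ∀ i j, 0 < A i j) (hx : ∀ i, 0 < x i) {k : ℕ}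
    (h : ¬ IsPerronVector A (A ^ k *ᵥ x)) : lowerSeq A x (k + 1) < lowerSeq A x (k + 2) := by
  rw [lt_lowerSeq_succ_iff hA hx]
  intro i
  have := mulVec_pos_of_nonneg_of_ne_zero hA
    (z := A *ᵥ (A ^ k *ᵥ x) - lowerSeq A x (k + 1) • (A ^ k *ᵥ x))
    (fun i => sub_nonneg.mpr (lowerSeq_mul_le_mulVec hA hx k i))
    (fun h0 => h (isPerronVector_of_mulVec_eq hA (pow_mulVec_pos hA hx k) (sub_eq_zero.mp h0)))
    i
  rw [Matrix.mulVec_sub, Matrix.mulVec_smul] at this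
  rw [pow_succ_mulVec]
  exact sub_pos.mp this

theorem upperSeq_eq_perronValue (hA : ∀ i j, 0 < A i j) (hx : ∀ i, 0 < x i) {k : ℕ}
    (h : IsPerronVector A (A ^ k *ᵥ x)) : upperSeq A x (k + 1) = perronValue A := by
  have h1 := congrFun (isPerronVector_iff.mp h).1
  exact le_antisymm ((upperSeq_succ_le_iff hA hx).mpr fun i => (h1 i).le)
    (perronValue_le hA (pow_mulVec_pos hA hx k) (mulVec_le_upperSeq_mul hA hx k))

theorem lowerSeq_eq_perronValue (hA : ∀ i j, 0 < A i j) (hx : ∀ i, 0 < x i) {k : ℕ}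
    (h : IsPerronVector A (A ^ k *ᵥ x)) : lowerSeq A x (k + 1) = perronValue A := by
  have h1 := congrFun (isPerronVector_iff.mp h).1
  exact le_antisymm ((lowerSeq_le_upperSeq A x _).trans_eq (upperSeq_eq_perronValue hA hx h))
    ((le_lowerSeq_succ_iff hA hx).mpr fun i => (h1 i).ge)

end Iterates

/-! ### Convergence to the Perron value -/

section Convergence

variable [DecidableEq ι] [Nonempty ι] {A : Matrix ι ι ℝ} {x : ι → ℝ}

theorem upperSeq_succ_le (hA : ∀ i j, 0 < A i j) (hx : ∀ i, 0 < x i) (k : ℕ) :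
    upperSeq A x (k + 2) ≤ upperSeq A x (k + 1) := by
  by_cases h : IsPerronVector A (A ^ k *ᵥ x)
  · rw [upperSeq_eq_perronValue hA hx h, upperSeq_eq_perronValue hA hx (k := k + 1)
      (isPerronVector_pow_mulVec_of_le hA hx k.le_succ h)]
  · exact (upperSeq_succ_lt hA hx h).le

theorem lowerSeq_le_succ (hA : ∀ i j, 0 < A i j) (hx : ∀ i, 0 < x i) (k : ℕ) :
    lowerSeq A x (k + 1) ≤ lowerSeq A x (k + 2) := by
  by_cases h : IsPerronVector A (A ^ k *ᵥ x)
  · rw [lowerSeq_eq_perronValue hA hx h, lowerSeq_eq_perronValue hA hx (k := k + 1)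
      (isPerronVector_pow_mulVec_of_le hA hx k.le_succ h)]
  · exact (lt_lowerSeq_succ hA hx h).le

theorem antitone_upperSeq (hA : ∀ i j, 0 < A i j) (hx : ∀ i, 0 < x i) :
    Antitone fun k => upperSeq A x (k + 1) :=
  antitone_nat_of_succ_le (upperSeq_succ_le hA hx)

theorem monotone_lowerSeq (hA : ∀ i j, 0 < A i j) (hx : ∀ i, 0 < x i) :
    Monotone fun k => lowerSeq A x (k + 1) :=
  monotone_nat_of_le_succ (lowerSeq_le_succ hA hx)

/-- One step decreases the upper ratio by a fixed proportion of the gap. -/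
theorem exists_contraction (hA : ∀ i j, 0 < A i j) (hx : ∀ i, 0 < x i) :
    ∃ δ : ℝ, 0 < δ ∧ ∀ k, δ * (upperSeq A x (k + 2) - lowerSeq A x (k + 2)) ≤
      upperSeq A x (k + 2) - upperSeq A x (k + 3) := by
  obtain ⟨m, M, hm, hmA, hMA⟩ := exists_pos_forall_mem_Icc hA
  -- One constant for two bounds: `M / m` compares the entries of `y`, and `upperSeq A x 1` bounds
  -- all later upper ratios.
  set C := max (M / m) (upperSeq A x 1) with hCdef
  have hC0 : 0 < C := by
    refine lt_max_of_lt_left (div_pos ?_ hm)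
    exact hm.trans_le ((hmA (Classical.arbitrary ι) (Classical.arbitrary ι)).trans (hMA _ _))
  refine ⟨m / C ^ 2, by positivity, fun k => ?_⟩
  -- The exponent is `k + 1` because only a vector in the image of `A` has its entries comparable up
  -- to `M / m`.
  set y := A ^ (k + 1) *ᵥ x with hydef
  have hy : ∀ i, 0 < y i := pow_mulVec_pos hA hx (k + 1)
  set a := upperSeq A x (k + 2)
  set b := lowerSeq A x (k + 2)
  obtain ⟨j, hj⟩ := exists_lowerSeq_mul_eq hA hx (k + 1)
  have haC : a ≤ C := (antitone_upperSeq hA hx (Nat.zero_le (k + 1))).trans (le_max_right _ _)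
  have key := mul_mulVec_le_mulVec_of_apply_eq hm hmA (y := y) (z := a • y - A *ᵥ y) (C := C) (c := a - b)
    (j := j)
    (fun i l => by
      rw [hydef, pow_succ_mulVec]
      refine (mulVec_le_div_mul_mulVec hm hmA hMA
        (fun i => (pow_mulVec_pos hA hx k i).le) i l).trans ?_
      exact mul_le_mul_of_nonneg_right (le_max_left _ _)
        (mulVec_pos hA (pow_mulVec_pos hA hx k) l).le)
    (fun i => (mulVec_le_upperSeq_mul hA hx (k + 1) i).trans
      (mul_le_mul_of_nonneg_right haC (hy i).le))
    hC0 (fun i => sub_nonneg.mpr (mulVec_le_upperSeq_mul hA hx (k + 1) i))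
    (by
      simp only [Pi.sub_apply, Pi.smul_apply, smul_eq_mul, sub_mul]
      rw [hydef, hj])
    (sub_nonneg.mpr (lowerSeq_le_upperSeq A x _))
  rw [le_sub_comm, upperSeq_succ_le_iff hA hx]
  intro i
  have := key i
  rw [Matrix.mulVec_sub, Matrix.mulVec_smul] at this
  simp only [Pi.sub_apply, Pi.smul_apply, smul_eq_mul] at this
  rw [pow_succ_mulVec A x (k + 1), ← hydef]
  linarith

theorem exists_tendsto_upperSeq_lowerSeq (hA : ∀ i j, 0 < A i j) (hx : ∀ i, 0 < x i) :
    ∃ l, Tendsto (upperSeq A x) atTop (𝓝 l) ∧ Tendsto (lowerSeq A x) atTop (𝓝 l) := by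
  have hbdd : BddBelow (Set.range fun k => upperSeq A x (k + 1)) := by
    refine ⟨lowerSeq A x 1, ?_⟩
    rintro _ ⟨k, rfl⟩
    exact (monotone_lowerSeq hA hx (Nat.zero_le k)).trans (lowerSeq_le_upperSeq A x _)
  have h1 := tendsto_atTop_ciInf (antitone_upperSeq hA hx) hbdd
  set l := ⨅ k, upperSeq A x (k + 1)
  have ha : Tendsto (upperSeq A x) atTop (𝓝 l) := (tendsto_add_atTop_iff_nat 1).mp h1
  refine ⟨l, ha, ?_⟩
  obtain ⟨δ, hδ, hcon⟩ := exists_contraction hA hx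
  have h2 := (tendsto_add_atTop_iff_nat 2).mpr ha
  have h3 := (tendsto_add_atTop_iff_nat 3).mpr ha
  -- By the contraction these quotients dominate the gaps.
  have h4 : Tendsto (fun k => (upperSeq A x (k + 2) - upperSeq A x (k + 3)) / δ) atTop (𝓝 0) := by
    simpa using (h2.sub h3).div_const δ
  have h5 : Tendsto (fun k => upperSeq A x (k + 2) - lowerSeq A x (k + 2)) atTop (𝓝 0) := by
    refine squeeze_zero (fun k => sub_nonneg.mpr (lowerSeq_le_upperSeq A x _)) (fun k => ?_) h4
    rw [le_div_iff₀ hδ, mul_comm]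
    exact hcon k
  refine (tendsto_add_atTop_iff_nat 2).mp ?_
  simpa using h2.sub h5

/-- Iterates scaled into the compact simplex have a limit point `v`, nonzero as its entries sum to
1. Both ratio bounds pass to the limit and pinch `A v` to `l v`. -/
theorem le_perronValue_of_tendsto (hA : ∀ i j, 0 < A i j) (hx : ∀ i, 0 < x i) {l : ℝ}
    (ha : Tendsto (upperSeq A x) atTop (𝓝 l)) (hb : Tendsto (lowerSeq A x) atTop (𝓝 l)) :
    l ≤ perronValue A := by
  set s : ℕ → ℝ := fun k => ∑ i, (A ^ k *ᵥ x) i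
  have hs : ∀ k, 0 < s k := fun k =>
    Finset.sum_pos (fun i _ => pow_mulVec_pos hA hx k i) Finset.univ_nonempty
  set u : ℕ → ι → ℝ := fun k => (s k)⁻¹ • (A ^ k *ᵥ x) with hu
  have hmem : ∀ k, u k ∈ stdSimplex ℝ ι := fun k =>
    ⟨fun i => mul_nonneg (inv_nonneg.mpr (hs k).le) (pow_mulVec_pos hA hx k i).le, by
      simp only [hu, Pi.smul_apply, smul_eq_mul, ← Finset.mul_sum]
      exact inv_mul_cancel₀ (hs k).ne'⟩
  obtain ⟨v, hv, φ, hφ, hlim⟩ := (isCompact_stdSimplex ℝ ι).tendsto_subseq hmem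
  have hv0 : v ≠ 0 := by
    rintro rfl
    simpa using hv.2
  refine le_perronValue_of_mulVec_eq hA hv0 (funext fun i => ?_)
  have hcoord : Tendsto (fun k => u (φ k) i) atTop (𝓝 (v i)) := (tendsto_pi_nhds.mp hlim) i
  have hAcoord : Tendsto (fun k => (A *ᵥ u (φ k)) i) atTop (𝓝 ((A *ᵥ v) i)) := by
    have hc : Continuous fun w : ι → ℝ => (A *ᵥ w) i := by
      simp only [Matrix.mulVec, dotProduct]
      fun_prop
    exact (hc.tendsto v).comp hlim
  have hφ1 : Tendsto (fun k => φ k + 1) atTop atTop :=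
    (tendsto_add_atTop_nat 1).comp hφ.tendsto_atTop
  have hup := le_of_tendsto_of_tendsto' hAcoord ((ha.comp hφ1).mul hcoord) fun k => by
    simp only [hu, Matrix.mulVec_smul, Pi.smul_apply, smul_eq_mul, Function.comp_apply]
    rw [mul_left_comm]
    exact mul_le_mul_of_nonneg_left (mulVec_le_upperSeq_mul hA hx (φ k) i)
      (inv_nonneg.mpr (hs _).le)
  have hlow := le_of_tendsto_of_tendsto' ((hb.comp hφ1).mul hcoord) hAcoord fun k => by
    simp only [hu, Matrix.mulVec_smul, Pi.smul_apply, smul_eq_mul, Function.comp_apply]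
    rw [mul_left_comm]
    exact mul_le_mul_of_nonneg_left (lowerSeq_mul_le_mulVec hA hx (φ k) i)
      (inv_nonneg.mpr (hs _).le)
  exact le_antisymm hup hlow

theorem tendsto_upperSeq_lowerSeq (hA : ∀ i j, 0 < A i j) (hx : ∀ i, 0 < x i) :
    Tendsto (upperSeq A x) atTop (𝓝 (perronValue A)) ∧
      Tendsto (lowerSeq A x) atTop (𝓝 (perronValue A)) := by
  obtain ⟨l, ha, hb⟩ := exists_tendsto_upperSeq_lowerSeq hA hx
  have hl : l = perronValue A := by
    refine le_antisymm (le_perronValue_of_tendsto hA hx ha hb) ?_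
    exact ge_of_tendsto' ((tendsto_add_atTop_iff_nat 1).mpr ha) fun k =>
      perronValue_le hA (pow_mulVec_pos hA hx k) (mulVec_le_upperSeq_mul hA hx k)
  exact hl ▸ ⟨ha, hb⟩

/-- A general order-connected `s` serves both the half-line of (i) and the finite interval of (ii).
The step from `r + 1` to `r + 2` is governed by `A ^ r *ᵥ x`. -/
theorem strictAntiOn_upperSeq (hA : ∀ i j, 0 < A i j) (hx : ∀ i, 0 < x i) {s : Set ℕ}
    (hs : s.OrdConnected) (h1 : ∀ k ∈ s, 1 ≤ k)
    (h : ∀ r, r + 2 ∈ s → ¬ IsPerronVector A (A ^ r *ᵥ x)) : StrictAntiOn (upperSeq A x) s := by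
  refine strictAntiOn_of_succ_lt hs fun k _ hk hk' => ?_
  obtain ⟨r, rfl⟩ := Nat.exists_eq_add_of_le' (h1 k hk)
  exact upperSeq_succ_lt hA hx (h r hk')

theorem strictMonoOn_lowerSeq (hA : ∀ i j, 0 < A i j) (hx : ∀ i, 0 < x i) {s : Set ℕ}
    (hs : s.OrdConnected) (h1 : ∀ k ∈ s, 1 ≤ k)
    (h : ∀ r, r + 2 ∈ s → ¬ IsPerronVector A (A ^ r *ᵥ x)) : StrictMonoOn (lowerSeq A x) s := by
  refine strictMonoOn_of_lt_succ hs fun k _ hk hk' => ?_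
  obtain ⟨r, rfl⟩ := Nat.exists_eq_add_of_le' (h1 k hk)
  exact lt_lowerSeq_succ hA hx (h r hk')

end Convergence

end PerronSeq

theorem mainTheorem1 {ι : Type*} [Fintype ι] [DecidableEq ι] [Nonempty ι]
    (A : Matrix ι ι ℝ) (hA : ∀ i j, 0 < A i j) (x : ι → ℝ) (hx : ∀ i, 0 < x i) :
    ((∀ r : ℕ, ¬ PerronSeq.IsPerronVector A ((A ^ r).mulVec x)) →
      StrictAntiOn (PerronSeq.upperSeq A x) (Set.Ici 1) ∧
      StrictMonoOn (PerronSeq.lowerSeq A x) (Set.Ici 1) ∧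
      Filter.Tendsto (PerronSeq.upperSeq A x) Filter.atTop (nhds (PerronSeq.perronValue A)) ∧
      Filter.Tendsto (PerronSeq.lowerSeq A x) Filter.atTop (nhds (PerronSeq.perronValue A))) ∧
    (∀ r₀ : ℕ,
      IsLeast {s : ℕ | ∀ r : ℕ, s ≤ r → PerronSeq.IsPerronVector A ((A ^ r).mulVec x)} r₀ →
      StrictAntiOn (PerronSeq.upperSeq A x) (Set.Icc 1 (r₀ + 1)) ∧
      StrictMonoOn (PerronSeq.lowerSeq A x) (Set.Icc 1 (r₀ + 1)) ∧
      (∀ k : ℕ, r₀ + 1 ≤ k → PerronSeq.upperSeq A x k = PerronSeq.perronValue A) ∧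
      (∀ k : ℕ, r₀ + 1 ≤ k → PerronSeq.lowerSeq A x k = PerronSeq.perronValue A)) := by
  refine ⟨fun h => ⟨?_, ?_, PerronSeq.tendsto_upperSeq_lowerSeq hA hx⟩, fun r₀ h => ?_⟩
  · exact PerronSeq.strictAntiOn_upperSeq hA hx Set.ordConnected_Ici (fun _ hk => hk)
      fun r _ => h r
  · exact PerronSeq.strictMonoOn_lowerSeq hA hx Set.ordConnected_Ici (fun _ hk => hk)
      fun r _ => h r
  -- Here `r < r₀`. Being a Perron vector persists under `A`, so a single such `r` would contradict
  -- the minimality of `r₀`.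
  · have hnot : ∀ r, r + 2 ∈ Set.Icc 1 (r₀ + 1) →
        ¬ PerronSeq.IsPerronVector A ((A ^ r).mulVec x) := fun r hr hP => by
      have := h.2 fun s hs => PerronSeq.isPerronVector_pow_mulVec_of_le hA hx hs hP
      have := hr.2
      omega
    refine ⟨PerronSeq.strictAntiOn_upperSeq hA hx Set.ordConnected_Icc (fun _ hk => hk.1) hnot,
      PerronSeq.strictMonoOn_lowerSeq hA hx Set.ordConnected_Icc (fun _ hk => hk.1) hnot,
      fun k hk => ?_, fun k hk => ?_⟩
    all_goals obtain ⟨r, rfl⟩ := Nat.exists_eq_add_of_le' (le_of_add_le_right hk)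
    · exact PerronSeq.upperSeq_eq_perronValue hA hx (h.1 r (Nat.le_of_succ_le_succ hk))
    · exact PerronSeq.lowerSeq_eq_perronValue hA hx (h.1 r (Nat.le_of_succ_le_succ hk))
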